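/- Let $d\in C^1(\mathbb R)$ satisfy $d(0)=0$, $d'(s)>d_0$ and $|d'(s)|\le d_1+d_2|s|^{r}$ for all $s\in\mathbb R$, with constants $d_0>0$ and $d_1,d_2,r\ge 0$. Let $\bar f,\bar g\in L^2(0,1)$ and $\bar h=(\bar h(0),\bar h(1))\in\mathbb R^2$. Consider the semilinear damped hyperbolic system $$\partial_t p+\partial_x m=\bar f,\qquad \partial_t m+\partial_x p+d(m)=\bar g\quad\text{on }(0,1),\qquad p=\bar h\quad\text{on }\{0,1\},\qquad 0\le t\le T,$$ with initial values $p(0)=p_0$, $m(0)=m_0$, where $p_0,m_0\in H^1(0,1)$. There is a unique steady state $(\bar p,\bar m)\in H^1(0,1)\times H^1(0,1)$, that is, a unique solution of $$\partial_x\bar m=\bar f,\qquad \partial_x\bar p+d(\bar m)=\bar g\quad\text{on }(0,1),\qquad \bar p=\bar h\quad\text{on }\{0,1\}.$$ Write $E(q,v)=\tfrac12\|q\|_{L^2}^2+\tfrac12\|v\|_{L^2}^2$. Then, for every $T>0$ and every solution $(p,m)\in C([0,T];H^1\times H^1)\cap C^1([0,T];L^2\times L^2)$ of the system with these initial values, $$E\big(p(t)-\bar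 p,\;m(t)-\bar m\big)\le c\,e^{-\gamma t}\qquad\text{and}\qquad E\big(\partial_t p(t),\;\partial_t m(t)\big)\le c'\,e^{-\gamma t}\qquad\text{for all }0\le t\le T,$$ with constants $c,c',\gamma>0$ that depend only on $d_0,d_1,d_2,r$ and on upper bounds for $\|\bar f\|_{L^2}$, $\|\bar g\|_{L^2}$, $|\bar h|_2$, $\|p_0\|_{H^1}$, $\|m_0\|_{H^1}$; in particular they do not depend on $t$ or $T$. -/

import Mathlib

open MeasureTheory Set
open scoped ContDiff

noncomputable section

namespace DampedWave

/-- Lebesgue measure on the open unit interval `(0,1)`. -/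
abbrev unitMeasure : Measure ℝ := volume.restrict (Ioo (0 : ℝ) 1)

/-- The real Hilbert space `L²(0,1)`. -/
abbrev L2 : Type := Lp ℝ 2 unitMeasure

/-- `φ ∈ C_c^∞(0,1)`: smooth, with compact support contained in `(0,1)`. -/
structure IsTestFunction (φ : ℝ → ℝ) : Prop where
  smooth : ContDiff ℝ ∞ φ
  compact : HasCompactSupport φ
  support : tsupport φ ⊆ Ioo (0 : ℝ) 1

theorem IsTestFunction.memLp {φ : ℝ → ℝ} (hφ : IsTestFunction φ) : MemLp φ 2 unitMeasure :=
  (hφ.smooth.continuous.memLp_of_hasCompactSupport hφ.compact).restrict _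

theorem IsTestFunction.memLp_deriv {φ : ℝ → ℝ} (hφ : IsTestFunction φ) :
    MemLp (deriv φ) 2 unitMeasure :=
  ((hφ.smooth.continuous_deriv (by simp)).memLp_of_hasCompactSupport
    hφ.compact.deriv).restrict _

/-- `v ∈ L²(0,1)` is the weak derivative of `u ∈ L²(0,1)`. -/
def HasWeakDeriv (u v : L2) : Prop :=
  ∀ φ : ℝ → ℝ, IsTestFunction φ →
    ∫ x in Ioo (0 : ℝ) 1, u x * deriv φ x = -∫ x in Ioo (0 : ℝ) 1, v x * φ x

theorem integral_add_mul (u v : L2) {ψ : ℝ → ℝ} (hψ : MemLp ψ 2 unitMeasure) :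
    ∫ x in Ioo (0 : ℝ) 1, (u + v) x * ψ x
      = (∫ x in Ioo (0 : ℝ) 1, u x * ψ x) + ∫ x in Ioo (0 : ℝ) 1, v x * ψ x := by
  have hu : Integrable (fun x => u x * ψ x) unitMeasure := (Lp.memLp u).integrable_mul hψ
  have hv : Integrable (fun x => v x * ψ x) unitMeasure := (Lp.memLp v).integrable_mul hψ
  rw [← integral_add hu hv]
  refine integral_congr_ae ?_
  filter_upwards [Lp.coeFn_add u v] with x hx
  rw [hx, Pi.add_apply, add_mul]

theorem integral_smul_mul (a : ℝ) (u : L2) (ψ : ℝ → ℝ) :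
    ∫ x in Ioo (0 : ℝ) 1, (a • u) x * ψ x = a * ∫ x in Ioo (0 : ℝ) 1, u x * ψ x := by
  rw [← integral_const_mul]
  refine integral_congr_ae ?_
  filter_upwards [Lp.coeFn_smul a u] with x hx
  rw [hx, Pi.smul_apply, smul_eq_mul, mul_assoc]

theorem integral_zero_mul (ψ : ℝ → ℝ) :
    ∫ x in Ioo (0 : ℝ) 1, (0 : L2) x * ψ x = 0 := by
  have h := integral_smul_mul 0 (0 : L2) ψ
  rwa [zero_smul, zero_mul] at h

/-- The Sobolev space `H¹(0,1)` as the subspace of the Hilbert space `L²(0,1) × L²(0,1)` of all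
pairs `(u, ∂ₓu)` with `∂ₓu` the weak derivative of `u`. The inherited norm is
`‖u‖²_{H¹} = ‖u‖²_{L²} + ‖∂ₓu‖²_{L²}`. -/
def sobolevSubmodule : Submodule ℝ (WithLp 2 (L2 × L2)) where
  carrier := {w | HasWeakDeriv w.fst w.snd}
  zero_mem' := by
    intro φ _
    change ∫ x in Ioo (0 : ℝ) 1, (0 : L2) x * deriv φ x
      = -∫ x in Ioo (0 : ℝ) 1, (0 : L2) x * φ x
    rw [integral_zero_mul, integral_zero_mul, neg_zero]
  add_mem' := by
    intro a b ha hb φ hφ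
    change ∫ x in Ioo (0 : ℝ) 1, (a.fst + b.fst) x * deriv φ x
      = -∫ x in Ioo (0 : ℝ) 1, (a.snd + b.snd) x * φ x
    rw [integral_add_mul _ _ hφ.memLp_deriv, integral_add_mul _ _ hφ.memLp, ha φ hφ, hb φ hφ]
    ring
  smul_mem' := by
    intro c a ha φ hφ
    change ∫ x in Ioo (0 : ℝ) 1, (c • a.fst) x * deriv φ x
      = -∫ x in Ioo (0 : ℝ) 1, (c • a.snd) x * φ x
    rw [integral_smul_mul, integral_smul_mul, ha φ hφ]
    ring

/-- The Sobolev space `H¹(0,1)`. -/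
abbrev H1 : Type := ↥sobolevSubmodule

/-- The function in `L²(0,1)` underlying an element of `H¹(0,1)`. -/
def H1.fn (u : H1) : L2 := u.1.fst

/-- The weak derivative `∂ₓu ∈ L²(0,1)` of `u ∈ H¹(0,1)`. -/
def H1.dx (u : H1) : L2 := u.1.snd

/-- The boundary values (traces) of `u` at `x = 0` and `x = 1` are `h 0` and `h 1`: the
representative of `u` that is continuous on `[0,1]` takes these values. -/
def HasBoundaryValues (u : H1) (h : EuclideanSpace ℝ (Fin 2)) : Prop :=
  ∃ w : ℝ → ℝ, ContinuousOn w (Icc 0 1) ∧ u.fn =ᵐ[unitMeasure] w ∧ w 0 = h 0 ∧ w 1 = h 1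

/-- The assumptions on the damping function `d`. -/
structure DampingAssumption (d₀ d₁ d₂ r : ℝ) (d : ℝ → ℝ) : Prop where
  contDiff : ContDiff ℝ 1 d
  map_zero : d 0 = 0
  lower : ∀ s, d₀ < deriv d s
  upper : ∀ s, |deriv d s| ≤ d₁ + d₂ * |s| ^ r

/-- `(p, m) ∈ H¹(0,1) × H¹(0,1)` is a steady state:
`∂ₓm = f`, `∂ₓp + d(m) = g` on `(0,1)` and `p = h` on `{0,1}`. -/
structure IsSteadyState (d : ℝ → ℝ) (f g : L2) (h : EuclideanSpace ℝ (Fin 2))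
    (p m : H1) : Prop where
  mass : m.dx = f
  momentum : ∀ᵐ x ∂unitMeasure, p.dx x + d (m.fn x) = g x
  boundary : HasBoundaryValues p h

/-- The time derivative, in `L²(0,1)`, of `u : [0,T] → H¹(0,1)` (one-sided at `0` and `T`). -/
def dt (T : ℝ) (u : ℝ → H1) (t : ℝ) : L2 := derivWithin (fun s => (u s).fn) (Icc 0 T) t

/-- `(p, m) ∈ C([0,T]; H¹ × H¹) ∩ C¹([0,T]; L² × L²)` solves
`∂ₜp + ∂ₓm = f`, `∂ₜm + ∂ₓp + d(m) = g` on `(0,1)` and `p = h` on `{0,1}`, for all `t ∈ [0,T]`,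
with `p(0) = p₀` and `m(0) = m₀`. -/
structure IsSolution (d : ℝ → ℝ) (f g : L2) (h : EuclideanSpace ℝ (Fin 2)) (p₀ m₀ : H1)
    (T : ℝ) (p m : ℝ → H1) : Prop where
  continuousOn_p : ContinuousOn p (Icc 0 T)
  continuousOn_m : ContinuousOn m (Icc 0 T)
  contDiffOn_p : ContDiffOn ℝ 1 (fun t => (p t).fn) (Icc 0 T)
  contDiffOn_m : ContDiffOn ℝ 1 (fun t => (m t).fn) (Icc 0 T)
  mass : ∀ t ∈ Icc 0 T, dt T p t + (m t).dx = f
  momentum : ∀ t ∈ Icc 0 T, ∀ᵐ x ∂unitMeasure,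
    dt T m t x + (p t).dx x + d ((m t).fn x) = g x
  boundary : ∀ t ∈ Icc 0 T, HasBoundaryValues (p t) h
  initial_p : p 0 = p₀
  initial_m : m 0 = m₀

/-- The energy `E(q,v) = ½‖q‖² + ½‖v‖²` (norms of `L²(0,1)`). -/
def energy (q v : L2) : ℝ := 1 / 2 * ‖q‖ ^ 2 + 1 / 2 * ‖v‖ ^ 2

end DampedWave

end

/-! The difference `(q, v)` of two solutions with the same data satisfies `∂ₜq = -∂ₓv`, `∂ₜv = -∂ₓq
- b`, where `q` vanishes at both ends and `b` is the difference of the damping terms. The coupling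
terms cancel in the energy, and monotonicity of `d` gives `dE/dt ≤ -d₀‖v‖²`. This controls only `v`.
Decay of `q` comes from subtracting `ε⟪v, K q⟫`, with `K` the mean-zero primitive: its derivative
contributes `-ε‖q‖²`, and the remaining terms are absorbed for small `ε` (`lyapunov_dissipation`),
provided `‖b‖ ≤ D‖v‖`.

Such a `D` requires a sup bound on the flux, since `d'` is bounded only locally. Plain energy
monotonicity (`energy_sub_le`) supplies it: comparison with the steady state bounds `‖m‖`,
comparison with time translates bounds `‖∂ₜp‖`, hence `‖∂ₓm‖ = ‖f - ∂ₜp‖`, and Sobolev's inequality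
concludes (`ae_abs_m_le`).

Both decay estimates are then instances of `energy_sub_le_exp`: solution against steady state, and
solution against its translate, divided by the shift squared in the limit. Hence no second time
derivatives are needed. -/

namespace DampedWave

open scoped RealInnerProductSpace

/-! ### The primitive as an operator on `L²(0,1)`, and integration by parts. -/

instance isProbabilityMeasure_unitMeasure : IsProbabilityMeasure unitMeasure :=
  ⟨by simp⟩

theorem integrable_coe (v : L2) : Integrable v unitMeasure :=
  (Lp.memLp v).integrable one_le_two

theorem integrable_indicator_coe (v : L2) : Integrable ((Ioo (0 : ℝ) 1).indicator v) :=
  (integrable_indicator_iff measurableSet_Ioo).2 (integrable_coe v)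

theorem intervalIntegral_indicator (f : ℝ → ℝ) :
    ∫ x in (0 : ℝ)..1, (Ioo (0 : ℝ) 1).indicator f x = ∫ x in Ioo (0 : ℝ) 1, f x := by
  rw [intervalIntegral.integral_of_le zero_le_one, integral_Ioc_eq_integral_Ioo,
    setIntegral_indicator measurableSet_Ioo, inter_self]

theorem integral_abs_le_norm (v : L2) : ∫ x in Ioo (0 : ℝ) 1, |v x| ≤ ‖v‖ := by
  have h := eLpNorm_le_eLpNorm_of_exponent_le (one_le_two : (1 : ENNReal) ≤ 2)
    (Lp.aestronglyMeasurable v)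
  have h' := ENNReal.toReal_mono (Lp.eLpNorm_ne_top v) h
  rw [← Lp.norm_def, eLpNorm_one_eq_lintegral_enorm,
    ← integral_norm_eq_lintegral_enorm (Lp.aestronglyMeasurable v)] at h'
  exact h'

/-- The primitive `x ↦ ∫₀ˣ v` of a function on `(0,1)`. -/
noncomputable def prim (v : L2) (x : ℝ) : ℝ := ∫ y in (0 : ℝ)..x, (Ioo (0 : ℝ) 1).indicator v y

theorem continuous_prim (v : L2) : Continuous (prim v) :=
  (integrable_indicator_coe v).continuous_primitive 0

@[simp] theorem prim_at_zero (v : L2) : prim v 0 = 0 := by simp [prim]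

theorem prim_one (v : L2) : prim v 1 = ∫ x in Ioo (0 : ℝ) 1, v x := intervalIntegral_indicator _

theorem abs_prim_le (v : L2) (x : ℝ) : |prim v x| ≤ ‖v‖ := by
  refine le_trans ?_ (integral_abs_le_norm v)
  rw [← integral_indicator measurableSet_Ioo]
  have h := (integrable_indicator_coe v).norm
  refine (intervalIntegral.norm_integral_le_integral_norm_uIoc (f := (Ioo (0 : ℝ) 1).indicator v)
    (a := 0) (b := x)).trans ?_
  refine (setIntegral_le_integral h (Filter.Eventually.of_forall fun _ => norm_nonneg _)).trans ?_
  refine le_of_eq (integral_congr_ae (Filter.Eventually.of_forall fun y => ?_))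
  simp [indicator]
  split_ifs <;> simp

theorem memLp_prim (v : L2) : MemLp (prim v) 2 unitMeasure :=
  MemLp.of_bound (continuous_prim v).aestronglyMeasurable ‖v‖
    (Filter.Eventually.of_forall (abs_prim_le v))

theorem indicator_congr_ae {f g : ℝ → ℝ} (h : f =ᵐ[unitMeasure] g) :
    (Ioo (0 : ℝ) 1).indicator f =ᵐ[volume] (Ioo (0 : ℝ) 1).indicator g := by
  filter_upwards [(ae_restrict_iff' measurableSet_Ioo).1 h] with x hx
  by_cases hm : x ∈ Ioo (0 : ℝ) 1
  · simp only [indicator_of_mem hm, hx hm]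
  · simp only [indicator_of_notMem hm]

theorem prim_add (u v : L2) (x : ℝ) : prim (u + v) x = prim u x + prim v x := by
  unfold prim
  rw [← intervalIntegral.integral_add (integrable_indicator_coe u).intervalIntegrable
    (integrable_indicator_coe v).intervalIntegrable]
  refine intervalIntegral.integral_congr_ae ?_
  filter_upwards [indicator_congr_ae (Lp.coeFn_add u v)] with y hy _
  rw [hy, indicator_add']
  rfl

theorem prim_smul (c : ℝ) (v : L2) (x : ℝ) : prim (c • v) x = c * prim v x := by
  unfold prim
  rw [← intervalIntegral.integral_const_mul]
  refine intervalIntegral.integral_congr_ae ?_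
  filter_upwards [indicator_congr_ae (Lp.coeFn_smul c v)] with y hy _
  rw [hy]
  simp [indicator]

theorem norm_le_of_ae_abs_le {v : L2} {C : ℝ} (hC : 0 ≤ C) (h : ∀ᵐ x ∂unitMeasure, |v x| ≤ C) :
    ‖v‖ ≤ C := by
  have := Lp.norm_le_of_ae_bound (f := v) hC h
  simpa [measureUnivNNReal] using this

/-- The operator `v ↦ ∫₀ˣ v` on `L²(0,1)`. -/
noncomputable def J : L2 →L[ℝ] L2 :=
  LinearMap.mkContinuous
    { toFun := fun v => (memLp_prim v).toLp
      map_add' := fun u v => by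
        rw [← MemLp.toLp_add]
        exact MemLp.toLp_congr _ _ (Filter.Eventually.of_forall (prim_add u v))
      map_smul' := fun c v => by
        rw [RingHom.id_apply, ← MemLp.toLp_const_smul]
        exact MemLp.toLp_congr _ _ (Filter.Eventually.of_forall (prim_smul c v)) } 1
    (fun v => by
      rw [one_mul]
      refine norm_le_of_ae_abs_le (norm_nonneg _) ?_
      filter_upwards [MemLp.coeFn_toLp (memLp_prim v)] with x hx
      exact hx ▸ abs_prim_le v x)

theorem coeFn_J (v : L2) : J v =ᵐ[unitMeasure] prim v := MemLp.coeFn_toLp (memLp_prim v)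

theorem norm_J_le (v : L2) : ‖J v‖ ≤ ‖v‖ := by
  have := J.le_of_opNorm_le (LinearMap.mkContinuous_norm_le _ zero_le_one _) v
  rwa [one_mul] at this

/-- The constant function `1` in `L²(0,1)`. -/
noncomputable def one : L2 := Lp.const 2 unitMeasure 1

theorem coeFn_one : one =ᵐ[unitMeasure] fun _ => (1 : ℝ) := Lp.coeFn_const _ _ _

theorem inner_eq_integral (u v : L2) : ⟪u, v⟫ = ∫ x in Ioo (0 : ℝ) 1, u x * v x := by
  rw [MeasureTheory.L2.inner_def]
  simp [mul_comm]

theorem inner_one_left (v : L2) : ⟪one, v⟫ = ∫ x in Ioo (0 : ℝ) 1, v x := by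
  rw [inner_eq_integral]
  refine integral_congr_ae ?_
  filter_upwards [coeFn_one] with x hx
  rw [hx, one_mul]

theorem norm_one_L2 : ‖one‖ = 1 := by
  have : ⟪one, one⟫ = (1 : ℝ) := by
    rw [inner_one_left, integral_congr_ae coeFn_one]
    simp
  rw [real_inner_self_eq_norm_sq] at this
  nlinarith [norm_nonneg one]

theorem abs_inner_one_le (v : L2) : |⟪one, v⟫| ≤ ‖v‖ := by
  simpa [norm_one_L2] using abs_real_inner_le_norm one v

/-- Integration by parts for the primitive. -/
theorem inner_J_add_inner_J (v w : L2) :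
    ⟪J v, w⟫ + ⟪v, J w⟫ = ⟪one, v⟫ * ⟪one, w⟫ := by
  have hac : ∀ u : L2, AbsolutelyContinuousOnInterval (prim u) 0 1 := fun u =>
    (integrable_indicator_coe u).intervalIntegrable
      |>.absolutelyContinuousOnInterval_intervalIntegral (by simp)
  have hder : ∀ u : L2, ∀ᵐ x, x ∈ uIcc (0 : ℝ) 1 →
      deriv (prim u) x = (Ioo (0 : ℝ) 1).indicator u x := fun u => by
    filter_upwards [(integrable_indicator_coe u).intervalIntegrable
      (a := 0) (b := 1) |>.ae_hasDerivAt_integral] with x hx hm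
    exact (hx hm 0 (by simp)).deriv
  -- Primitives of `L²` functions are absolutely continuous, which suffices for the product rule;
  -- both vanish at `0`, so only the boundary term at `1` survives.
  have h := (hac v).integral_deriv_mul_eq_sub (hac w)
  rw [prim_at_zero, zero_mul, sub_zero, prim_one, prim_one, ← inner_one_left, ← inner_one_left]
    at h
  have hi : ∀ u₁ u₂ : L2, Integrable (fun x => u₁ x * u₂ x) unitMeasure := fun u₁ u₂ =>
    (Lp.memLp u₁).integrable_mul (Lp.memLp u₂)
  rw [← h, inner_eq_integral, inner_eq_integral, ← integral_add (hi _ _) (hi _ _),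
    ← intervalIntegral_indicator]
  refine intervalIntegral.integral_congr_ae ?_
  filter_upwards [hder v, hder w, (ae_restrict_iff' measurableSet_Ioo).1 (coeFn_J v),
    (ae_restrict_iff' measurableSet_Ioo).1 (coeFn_J w)] with x h1 h2 h3 h4 hm
  rw [h1 (uIoc_subset_uIcc hm), h2 (uIoc_subset_uIcc hm)]
  by_cases hx : x ∈ Ioo (0 : ℝ) 1
  · simp only [indicator_of_mem hx, h3 hx, h4 hx]
    ring
  · simp only [indicator_of_notMem hx]
    ring

end DampedWave

/-! ### Structure of `H¹(0,1)`: primitives, sup bound, traces. -/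

namespace DampedWave

open scoped RealInnerProductSpace

theorem IsTestFunction.eq_zero_of_notMem {φ : ℝ → ℝ} (hφ : IsTestFunction φ) {x : ℝ}
    (hx : x ∉ Ioo (0 : ℝ) 1) : φ x = 0 :=
  image_eq_zero_of_notMem_tsupport fun h => hx (hφ.support h)

/-- A test function of mean zero is the derivative of a test function. -/
theorem IsTestFunction.exists_deriv_eq {φ : ℝ → ℝ} (hφ : IsTestFunction φ)
    (h0 : ∫ x in Ioo (0 : ℝ) 1, φ x = 0) : ∃ Φ, IsTestFunction Φ ∧ deriv Φ = φ := by
  have hc : Continuous φ := hφ.smooth.continuous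
  have hint : ∀ a b, IntervalIntegrable φ volume a b := fun a b => hc.intervalIntegrable a b
  -- The extra point makes the set nonempty even for `φ = 0`.
  let K : Set ℝ := tsupport φ ∪ {1 / 2}
  have hK : IsCompact K := hφ.compact.isCompact.union isCompact_singleton
  have hne : K.Nonempty := ⟨1 / 2, Or.inr rfl⟩
  have hsub : K ⊆ Ioo (0 : ℝ) 1 :=
    union_subset hφ.support (singleton_subset_iff.2 ⟨by norm_num, by norm_num⟩)
  obtain ⟨a, haK, ha⟩ := hK.exists_isLeast hne
  obtain ⟨b, hbK, hb⟩ := hK.exists_isGreatest hne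
  have hzero : ∀ x, x ∉ Icc a b → φ x = 0 := fun x hx =>
    image_eq_zero_of_notMem_tsupport fun h => hx ⟨ha (Or.inl h), hb (Or.inl h)⟩
  let Φ : ℝ → ℝ := fun x => ∫ y in (0 : ℝ)..x, φ y
  have hder : deriv Φ = φ := funext fun x => hc.deriv_integral φ 0 x
  have hsupp : ∀ x, x ∉ Icc a b → Φ x = 0 := by
    intro x hx
    rcases lt_or_ge x a with hxa | hxa
    · refine intervalIntegral.integral_zero_ae (Filter.Eventually.of_forall fun y hy => ?_)
      refine hzero y fun hy' => ?_
      have := hy.2.trans_lt (max_lt (hsub haK).1 hxa)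
      exact absurd hy'.1 (not_le.2 this)
    · have hxb : b < x := lt_of_not_ge fun h => hx ⟨hxa, h⟩
      -- To the right of the support the primitive equals the full integral, which is zero by the
      -- mean condition.
      have h1 : ∫ y in (0 : ℝ)..1, φ y = 0 := by
        rw [intervalIntegral.integral_of_le zero_le_one, integral_Ioc_eq_integral_Ioo, h0]
      have h2 : ∫ y in (1 : ℝ)..x, φ y = 0 := by
        refine intervalIntegral.integral_zero_ae (Filter.Eventually.of_forall fun y hy => ?_)
        refine hzero y fun hy' => ?_
        have := (lt_min (hsub hbK).2 hxb).trans hy.1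
        exact absurd hy'.2 (not_le.2 this)
      change ∫ y in (0 : ℝ)..x, φ y = 0
      rw [← intervalIntegral.integral_add_adjacent_intervals (hint 0 1) (hint 1 x), h1, h2,
        add_zero]
  have htsupp : tsupport Φ ⊆ Icc a b := by
    refine closure_minimal (fun x hx => ?_) isClosed_Icc
    by_contra h
    exact hx (hsupp x h)
  refine ⟨Φ, ⟨?_, ?_, ?_⟩, hder⟩
  · rw [contDiff_infty_iff_deriv, hder]
    exact ⟨fun x => (hc.integral_hasStrictDerivAt 0 x).hasDerivAt.differentiableAt, hφ.smooth⟩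
  · exact isCompact_Icc.of_isClosed_subset (isClosed_tsupport Φ) htsupp
  · exact fun x hx => ⟨(hsub haK).1.trans_le (htsupp hx).1, (htsupp hx).2.trans_lt (hsub hbK).2⟩

theorem exists_isTestFunction_integral_eq_one :
    ∃ ψ : ℝ → ℝ, IsTestFunction ψ ∧ ∫ x in Ioo (0 : ℝ) 1, ψ x = 1 := by
  let f : ContDiffBump (1 / 2 : ℝ) := ⟨1 / 8, 1 / 4, by norm_num, by norm_num⟩
  have hs : tsupport (f.normed volume) ⊆ Ioo (0 : ℝ) 1 := by
    rw [f.tsupport_normed_eq, Real.closedBall_eq_Icc]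
    exact fun x hx => ⟨by linarith [hx.1, show f.rOut = 1 / 4 from rfl],
      by linarith [hx.2, show f.rOut = 1 / 4 from rfl]⟩
  have hψ : IsTestFunction (f.normed volume) :=
    ⟨f.contDiff_normed, f.hasCompactSupport_normed, hs⟩
  refine ⟨_, hψ, ?_⟩
  rw [setIntegral_eq_integral_of_forall_compl_eq_zero fun x hx => hψ.eq_zero_of_notMem hx]
  exact f.integral_normed

/-- The lemma of du Bois-Reymond on `(0,1)`. -/
theorem exists_eq_const_of_integral_mul_deriv_eq_zero {z : L2}
    (hz : ∀ φ, IsTestFunction φ → ∫ x in Ioo (0 : ℝ) 1, z x * deriv φ x = 0) :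
    ∃ c : ℝ, z = c • one := by
  obtain ⟨ψ, hψ, hψ1⟩ := exists_isTestFunction_integral_eq_one
  set c : ℝ := ∫ x in Ioo (0 : ℝ) 1, z x * ψ x with hc
  have hzi := integrable_coe z
  have hloc : LocallyIntegrableOn (fun x => z x - c) (Ioo (0 : ℝ) 1) := by
    refine IntegrableOn.locallyIntegrableOn ?_
    exact hzi.sub (integrable_const c)
  have key := isOpen_Ioo.ae_eq_zero_of_integral_contDiff_smul_eq_zero hloc (fun g hg hgc hgs => by
    have hgt : IsTestFunction g := ⟨hg, hgc, hgs⟩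
    rw [← setIntegral_eq_integral_of_forall_compl_eq_zero (s := Ioo (0 : ℝ) 1)
      fun x hx => by rw [hgt.eq_zero_of_notMem hx, zero_smul]]
    set a : ℝ := ∫ x in Ioo (0 : ℝ) 1, g x with ha
    have hgi : Integrable g unitMeasure := hgt.memLp.integrable one_le_two
    have hψi : Integrable ψ unitMeasure := hψ.memLp.integrable one_le_two
    -- Removing the mean of `g` makes it the derivative of a test function, to which the hypothesis
    -- on `z` applies; the removed part accounts for the constant `c = ∫ zψ`.
    have hφ : IsTestFunction (fun x => g x - a * ψ x) := by
      refine ⟨hg.sub (contDiff_const.mul hψ.smooth), hgc.sub (hψ.compact.mul_left), ?_⟩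
      refine (tsupport_sub g _).trans (union_subset hgs ?_)
      exact (closure_mono (Function.support_mul_subset_right (fun _ => a) ψ)).trans hψ.support
    have hφ0 : ∫ x in Ioo (0 : ℝ) 1, (g x - a * ψ x) = 0 := by
      rw [integral_sub hgi (hψi.const_mul a), integral_const_mul, hψ1, mul_one, ← ha, sub_self]
    obtain ⟨Φ, hΦ, hd⟩ := hφ.exists_deriv_eq hφ0
    have h := hz Φ hΦ
    have hzg : Integrable (fun x => z x * g x) unitMeasure := (Lp.memLp z).integrable_mul hgt.memLp
    have hzψ : Integrable (fun x => z x * ψ x) unitMeasure := (Lp.memLp z).integrable_mul hψ.memLp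
    have h1 : ∫ x in Ioo (0 : ℝ) 1, z x * deriv Φ x
        = (∫ x in Ioo (0 : ℝ) 1, z x * g x) - a * c := by
      rw [hd, hc, ← integral_const_mul, ← integral_sub hzg (hzψ.const_mul a)]
      exact integral_congr_ae (Filter.Eventually.of_forall fun x => by simp only; ring)
    have h2 : ∫ x in Ioo (0 : ℝ) 1, g x • (z x - c)
        = (∫ x in Ioo (0 : ℝ) 1, z x * g x) - c * a := by
      rw [ha, ← integral_const_mul, ← integral_sub hzg (hgi.const_mul c)]
      exact integral_congr_ae (Filter.Eventually.of_forall fun x => by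
        simp only [smul_eq_mul]; ring)
    rw [h2, mul_comm c a, ← h1, h])
  refine ⟨c, Lp.ext ?_⟩
  filter_upwards [(ae_restrict_iff' measurableSet_Ioo).2 key, Lp.coeFn_smul c one, coeFn_one]
    with x h1 h2 h3
  rw [h2, Pi.smul_apply, h3, smul_eq_mul, mul_one]
  linarith

theorem prim_toLp {f : ℝ → ℝ} (hf : MemLp f 2 unitMeasure) {x : ℝ} (hx : x ∈ Icc (0 : ℝ) 1) :
    prim hf.toLp x = ∫ y in (0 : ℝ)..x, f y := by
  refine intervalIntegral.integral_congr_ae ?_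
  filter_upwards [indicator_congr_ae hf.coeFn_toLp, (measure_eq_zero_iff_ae_notMem.1
    (measure_singleton (1 : ℝ)) : ∀ᵐ y ∂(volume : Measure ℝ), y ∉ ({1} : Set ℝ))] with y h1 h2 hy
  rw [uIoc_of_le hx.1] at hy
  rw [h1, indicator_of_mem]
  exact ⟨hy.1, lt_of_le_of_ne (hy.2.trans hx.2) h2⟩

theorem IsTestFunction.prim_deriv {φ : ℝ → ℝ} (hφ : IsTestFunction φ) {x : ℝ}
    (hx : x ∈ Icc (0 : ℝ) 1) : prim hφ.memLp_deriv.toLp x = φ x := by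
  rw [prim_toLp _ hx, intervalIntegral.integral_deriv_eq_sub
    (fun y _ => (hφ.smooth.differentiable (by simp)) y)
    ((hφ.smooth.continuous_deriv (by simp)).intervalIntegrable _ _),
    hφ.eq_zero_of_notMem (x := 0) (by simp), sub_zero]

theorem IsTestFunction.J_deriv {φ : ℝ → ℝ} (hφ : IsTestFunction φ) :
    J hφ.memLp_deriv.toLp = hφ.memLp.toLp := by
  refine Lp.ext ?_
  filter_upwards [coeFn_J hφ.memLp_deriv.toLp, hφ.memLp.coeFn_toLp,
    ae_restrict_mem measurableSet_Ioo] with x h1 h2 h3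
  rw [h1, h2, hφ.prim_deriv (Ioo_subset_Icc_self h3)]

theorem IsTestFunction.inner_one_deriv {φ : ℝ → ℝ} (hφ : IsTestFunction φ) :
    ⟪one, hφ.memLp_deriv.toLp⟫ = (0 : ℝ) := by
  rw [inner_one_left, ← prim_one, hφ.prim_deriv (by simp), hφ.eq_zero_of_notMem (by simp)]

theorem inner_toLp (u : L2) {f : ℝ → ℝ} (hf : MemLp f 2 unitMeasure) :
    ⟪u, hf.toLp⟫ = ∫ x in Ioo (0 : ℝ) 1, u x * f x := by
  rw [inner_eq_integral]
  refine integral_congr_ae ?_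
  filter_upwards [hf.coeFn_toLp] with x hx
  rw [hx]

theorem hasWeakDeriv_iff_inner {u v : L2} : HasWeakDeriv u v ↔
    ∀ φ, ∀ hφ : IsTestFunction φ, ⟪u, hφ.memLp_deriv.toLp⟫ = -⟪v, hφ.memLp.toLp⟫ := by
  simp only [inner_toLp]
  rfl

theorem hasWeakDeriv_const_add_J (c : ℝ) (v : L2) : HasWeakDeriv (c • one + J v) v := by
  refine hasWeakDeriv_iff_inner.2 fun φ hφ => ?_
  have h := inner_J_add_inner_J v hφ.memLp_deriv.toLp
  rw [hφ.J_deriv, hφ.inner_one_deriv] at h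
  rw [inner_add_left, real_inner_smul_left, hφ.inner_one_deriv]
  linarith

/-- Functions in `H¹(0,1)` are the primitives of their weak derivatives. -/
theorem HasWeakDeriv.exists_eq_const_add_J {u v : L2} (h : HasWeakDeriv u v) :
    ∃ c : ℝ, u = c • one + J v := by
  obtain ⟨c, hc⟩ := exists_eq_const_of_integral_mul_deriv_eq_zero (z := u - J v) fun φ hφ => by
    rw [← inner_toLp _ hφ.memLp_deriv, inner_sub_left, hasWeakDeriv_iff_inner.1 h φ hφ]
    have h' := hasWeakDeriv_iff_inner.1 (hasWeakDeriv_const_add_J 0 v) φ hφ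
    rw [zero_smul, zero_add] at h'
    rw [h', sub_self]
  exact ⟨c, by rw [← hc, sub_add_cancel]⟩

theorem H1.exists_fn_eq (u : H1) : ∃ c : ℝ, u.fn = c • one + J u.dx :=
  HasWeakDeriv.exists_eq_const_add_J u.2

/-- The function `c + ∫₀ˣ v` as an element of `H¹(0,1)`. -/
noncomputable def H1.ofDeriv (c : ℝ) (v : L2) : H1 :=
  ⟨WithLp.toLp 2 (c • one + J v, v), hasWeakDeriv_const_add_J c v⟩

@[simp] theorem H1.fn_ofDeriv (c : ℝ) (v : L2) : (H1.ofDeriv c v).fn = c • one + J v := rfl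

@[simp] theorem H1.dx_ofDeriv (c : ℝ) (v : L2) : (H1.ofDeriv c v).dx = v := rfl

theorem H1.ext {u v : H1} (h : u.fn = v.fn) (h' : u.dx = v.dx) : u = v :=
  Subtype.ext (WithLp.ofLp_injective 2 (Prod.ext h h'))

theorem H1.norm_fn_le (u : H1) : ‖u.fn‖ ≤ ‖u‖ := WithLp.norm_fst_le _ u.1

theorem H1.norm_dx_le (u : H1) : ‖u.dx‖ ≤ ‖u‖ := WithLp.norm_snd_le _ u.1

theorem coeFn_const_add_J (c : ℝ) (v : L2) :
    (c • one + J v : L2) =ᵐ[unitMeasure] fun x => c + prim v x := by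
  filter_upwards [Lp.coeFn_add (c • one) (J v), Lp.coeFn_smul c one, coeFn_one, coeFn_J v]
    with x h1 h2 h3 h4
  rw [h1, Pi.add_apply, h2, Pi.smul_apply, h3, h4, smul_eq_mul, mul_one]

/-- Here `c` is the value at `0` of the primitive; together with `abs_prim_le` this yields the sup
bound. -/
theorem abs_const_le (c : ℝ) (v : L2) : |c| ≤ ‖c • one + J v‖ + ‖v‖ := by
  have h : ‖c • one‖ = |c| := by rw [norm_smul, norm_one_L2, mul_one, Real.norm_eq_abs]
  rw [← h]
  have := norm_sub_le (c • one + J v) (J v)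
  rw [add_sub_cancel_right] at this
  linarith [norm_J_le v]

/-- The Sobolev inequality `‖u‖_∞ ≤ ‖u‖ + 2‖∂ₓu‖`. -/
theorem H1.ae_abs_fn_le (u : H1) : ∀ᵐ x ∂unitMeasure, |u.fn x| ≤ ‖u.fn‖ + 2 * ‖u.dx‖ := by
  obtain ⟨c, hc⟩ := u.exists_fn_eq
  have h := abs_const_le c u.dx
  rw [← hc] at h
  have h' := coeFn_const_add_J c u.dx
  rw [← hc] at h'
  filter_upwards [h'] with x hx
  rw [hx]
  linarith [abs_add_le c (prim u.dx x), abs_prim_le u.dx x]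

theorem HasBoundaryValues.fn_eq {u : H1} {h : EuclideanSpace ℝ (Fin 2)}
    (hu : HasBoundaryValues u h) :
    u.fn = h 0 • one + J u.dx ∧ h 1 = h 0 + ⟪one, u.dx⟫ := by
  obtain ⟨w, hw, huw, h0, h1⟩ := hu
  obtain ⟨c, hc⟩ := u.exists_fn_eq
  have h' := coeFn_const_add_J c u.dx
  rw [← hc] at h'
  -- The endpoints are null, and continuous functions that agree a.e. on `[0,1]` agree everywhere
  -- there, so the traces can be read off the primitive.
  have hae : w =ᵐ[volume.restrict (Icc (0 : ℝ) 1)] fun x => c + prim u.dx x := by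
    rw [← restrict_Ioo_eq_restrict_Icc]
    exact huw.symm.trans h'
  have heq := Measure.eqOn_Icc_of_ae_eq volume zero_ne_one hae hw
    (continuous_const.add (continuous_prim u.dx)).continuousOn
  have e0 := heq (left_mem_Icc.2 zero_le_one)
  have e1 := heq (right_mem_Icc.2 zero_le_one)
  simp only [prim_at_zero, add_zero, prim_one, ← inner_one_left] at e0 e1
  rw [h0] at e0
  rw [h1] at e1
  rw [e0]
  exact ⟨hc, e1⟩

theorem hasBoundaryValues_ofDeriv {v : L2} {h : EuclideanSpace ℝ (Fin 2)}
    (hv : h 1 = h 0 + ⟪one, v⟫) : HasBoundaryValues (H1.ofDeriv (h 0) v) h := by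
  refine ⟨fun x => h 0 + prim v x, (continuous_const.add (continuous_prim v)).continuousOn,
    coeFn_const_add_J _ _, by simp, ?_⟩
  simp only [prim_one, ← inner_one_left, hv]

end DampedWave

/-! ### The mean-zero primitive and the Lyapunov functional. -/

namespace DampedWave

open scoped RealInnerProductSpace

/-- The primitive of mean zero, as an operator on `L²(0,1)`. -/
noncomputable def K : L2 →L[ℝ] L2 := J - ((innerSL ℝ one).comp J).smulRight one

theorem K_apply (q : L2) : K q = J q - ⟪one, J q⟫ • one := rfl

theorem norm_K_le (q : L2) : ‖K q‖ ≤ 2 * ‖q‖ := by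
  rw [K_apply]
  refine (norm_sub_le _ _).trans ?_
  rw [norm_smul, norm_one_L2, mul_one, Real.norm_eq_abs]
  linarith [abs_inner_one_le (J q), norm_J_le q]

/-- The sum is the integral of `∂ₓ(qv)`. Since `q` vanishes at both ends, no boundary condition on
`v` is needed. -/
theorem inner_add_inner_eq_zero {q qx v vx : L2} {c : ℝ} (hq : q = J qx) (h0 : ⟪one, qx⟫ = (0 : ℝ))
    (hv : v = c • one + J vx) : ⟪q, vx⟫ + ⟪v, qx⟫ = (0 : ℝ) := by
  have h := inner_J_add_inner_J qx vx
  rw [h0, zero_mul, ← hq] at h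
  rw [hv, inner_add_left, real_inner_smul_left, h0, real_inner_comm qx]
  linarith

/-- This is the source of dissipation in `q`: integrate by parts; the constant in `K q` is invisible
because `qx` has mean zero. -/
theorem inner_K_self {q qx : L2} (hq : q = J qx) (h0 : ⟪one, qx⟫ = (0 : ℝ)) :
    ⟪qx, K q⟫ = -‖q‖ ^ 2 := by
  have h := inner_J_add_inner_J qx q
  rw [h0, zero_mul, ← hq, real_inner_self_eq_norm_sq] at h
  rw [K_apply, inner_sub_right, real_inner_smul_right, real_inner_comm one qx, h0]
  linarith

/-- `K vx` is `v` minus its mean, whatever the boundary values of `v`; this is why the primitive is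
normalised to mean zero. -/
theorem inner_K_deriv_le {v vx : L2} {c : ℝ} (hv : v = c • one + J vx) :
    ⟪v, K vx⟫ ≤ ‖v‖ ^ 2 := by
  have h1 : ⟪one, one⟫ = (1 : ℝ) := by rw [real_inner_self_eq_norm_sq, norm_one_L2, one_pow]
  have hJ : J vx = v - c • one := by rw [hv, add_sub_cancel_left]
  rw [K_apply, hJ]
  simp only [inner_sub_right, real_inner_smul_right, h1, real_inner_self_eq_norm_sq,
    real_inner_comm one v]
  nlinarith [sq_nonneg (⟪one, v⟫ : ℝ)]

theorem le_exp_mul_of_hasDerivAt_le {L L' : ℝ → ℝ} {S γ : ℝ} (hc : ContinuousOn L (Icc 0 S))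
    (hd : ∀ t ∈ Ioo 0 S, HasDerivAt L (L' t) t) (hle : ∀ t ∈ Ioo 0 S, L' t ≤ -γ * L t)
    {t : ℝ} (ht : t ∈ Icc 0 S) : L t ≤ Real.exp (-γ * t) * L 0 := by
  have hder : ∀ s ∈ Ioo 0 S, HasDerivAt (fun s => Real.exp (γ * s) * L s)
      (Real.exp (γ * s) * γ * L s + Real.exp (γ * s) * L' s) s := fun s hs => by
    have := ((hasDerivAt_id s).const_mul γ).exp.fun_mul (hd s hs)
    simpa using this
  have hanti : AntitoneOn (fun s => Real.exp (γ * s) * L s) (Icc 0 S) := by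
    refine antitoneOn_of_deriv_nonpos (convex_Icc 0 S)
      ((Real.continuous_exp.comp (continuous_const.mul continuous_id)).continuousOn.mul hc) ?_ ?_
    · rw [interior_Icc]
      exact fun s hs => (hder s hs).differentiableAt.differentiableWithinAt
    · rw [interior_Icc]
      intro s hs
      rw [(hder s hs).deriv]
      nlinarith [hle s hs, Real.exp_pos (γ * s)]
  have h := hanti (left_mem_Icc.2 (ht.1.trans ht.2)) ht ht.1
  simp only [mul_zero, Real.exp_zero, one_mul] at h
  rw [neg_mul, Real.exp_neg, inv_mul_eq_div, le_div_iff₀ (Real.exp_pos _), mul_comm]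
  exact h

/-- The weight of the cross term in the Lyapunov functional. -/
noncomputable def weight (d₀ D : ℝ) : ℝ := d₀ / (3 / 2 + 2 * D ^ 2 + 4 * d₀)

theorem weight_pos {d₀ : ℝ} (hd₀ : 0 < d₀) (D : ℝ) : 0 < weight d₀ D := by
  unfold weight
  positivity

theorem weight_mul {d₀ : ℝ} (hd₀ : 0 < d₀) (D : ℝ) :
    weight d₀ D * (3 / 2 + 2 * D ^ 2 + 4 * d₀) = d₀ :=
  div_mul_cancel₀ _ (by positivity)

theorem weight_le {d₀ : ℝ} (hd₀ : 0 < d₀) (D : ℝ) : weight d₀ D ≤ 1 / 4 := by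
  unfold weight
  rw [div_le_iff₀ (by positivity)]
  nlinarith [sq_nonneg D]

/-- The Lyapunov functional: the energy perturbed by a cross term. -/
noncomputable def lyapunov (ε : ℝ) (q v : L2) : ℝ := energy q v - ε * ⟪v, K q⟫

/-- Makes the Lyapunov functional comparable to the energy, with factors `1/2` and `3/2`. -/
theorem abs_cross_le {ε : ℝ} (h0 : 0 ≤ ε) (h : ε ≤ 1 / 4) (q v : L2) :
    |ε * ⟪v, K q⟫| ≤ energy q v / 2 := by
  have h1 : |(⟪v, K q⟫ : ℝ)| ≤ ‖v‖ * (2 * ‖q‖) :=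
    (abs_real_inner_le_norm _ _).trans (mul_le_mul_of_nonneg_left (norm_K_le q) (norm_nonneg v))
  rw [abs_mul, abs_of_nonneg h0]
  have h2 : ε * |(⟪v, K q⟫ : ℝ)| ≤ 1 / 4 * (‖v‖ * (2 * ‖q‖)) :=
    mul_le_mul h h1 (abs_nonneg _) (by norm_num)
  unfold energy
  nlinarith [sq_nonneg (‖v‖ - ‖q‖)]

/-- Dissipation of the Lyapunov functional. -/
theorem lyapunov_dissipation {d₀ D : ℝ} (hd₀ : 0 < d₀) (hD : 0 ≤ D) {q qx v vx b : L2} {c : ℝ}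
    (hq : q = J qx) (h0 : ⟪one, qx⟫ = (0 : ℝ)) (hv : v = c • one + J vx)
    (hbv : d₀ * ‖v‖ ^ 2 ≤ ⟪b, v⟫) (hb : ‖b‖ ≤ D * ‖v‖) :
    ⟪q, -vx⟫ + ⟪v, -qx - b⟫ - weight d₀ D * (⟪v, K (-vx)⟫ + ⟪-qx - b, K q⟫)
      ≤ -(2 / 3 * weight d₀ D) * lyapunov (weight d₀ D) q v := by
  have hε := weight_pos hd₀ D
  have hmul := weight_mul hd₀ D
  have hcross := abs_cross_le hε.le (weight_le hd₀ D) q v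
  set ε := weight d₀ D
  have e1 := inner_add_inner_eq_zero hq h0 hv
  have e2 := inner_K_self hq h0
  have e3 := inner_K_deriv_le hv
  have e4 : |(⟪b, K q⟫ : ℝ)| ≤ D * ‖v‖ * (2 * ‖q‖) :=
    (abs_real_inner_le_norm _ _).trans
      (mul_le_mul hb (norm_K_le q) (norm_nonneg _) (by positivity))
  have e5 : D * ‖v‖ * (2 * ‖q‖) ≤ ‖q‖ ^ 2 / 2 + 2 * D ^ 2 * ‖v‖ ^ 2 := by
    nlinarith [sq_nonneg (‖q‖ - 2 * D * ‖v‖)]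
  have e6 : ε * ⟪b, K q⟫ ≤ ε * (‖q‖ ^ 2 / 2 + 2 * D ^ 2 * ‖v‖ ^ 2) :=
    mul_le_mul_of_nonneg_left ((le_abs_self _).trans (e4.trans e5)) hε.le
  have e7 : ε * ⟪v, K vx⟫ ≤ ε * ‖v‖ ^ 2 := mul_le_mul_of_nonneg_left e3 hε.le
  have e8 : ε * lyapunov ε q v ≤ ε * (3 / 2 * energy q v) := by
    refine mul_le_mul_of_nonneg_left ?_ hε.le
    unfold lyapunov
    linarith [neg_le_abs (ε * ⟪v, K q⟫ : ℝ)]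
  -- The cross term costs `ε(1 + 2D²)‖v‖²`, and the target rate `εE` costs another `(ε/2)‖v‖²`; this
  -- fixes the denominator of `weight`, whose summand `4 * d₀` only ensures `ε ≤ 1/4`.
  have e9 : 0 ≤ (d₀ - ε * (3 / 2 + 2 * D ^ 2)) * ‖v‖ ^ 2 :=
    mul_nonneg (by nlinarith) (sq_nonneg _)
  simp only [map_neg, inner_neg_right, inner_neg_left, inner_sub_left, inner_sub_right, e2,
    real_inner_comm b v] at *
  unfold energy at e8
  nlinarith

/-! ### Comparison of two solutions with the same data. -/

/-- A solution of the system on `[0,S]` with time derivatives in the interior. -/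
structure IsFlow (d : ℝ → ℝ) (f g : L2) (h : EuclideanSpace ℝ (Fin 2)) (S : ℝ)
    (p m : ℝ → H1) (p' m' : ℝ → L2) : Prop where
  continuousOn_p : ContinuousOn (fun t => (p t).fn) (Icc 0 S)
  continuousOn_m : ContinuousOn (fun t => (m t).fn) (Icc 0 S)
  hasDerivAt_p : ∀ t ∈ Ioo 0 S, HasDerivAt (fun s => (p s).fn) (p' t) t
  hasDerivAt_m : ∀ t ∈ Ioo 0 S, HasDerivAt (fun s => (m s).fn) (m' t) t
  mass : ∀ t ∈ Ioo 0 S, p' t + (m t).dx = f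
  momentum : ∀ t ∈ Ioo 0 S, ∀ᵐ x ∂unitMeasure, m' t x + (p t).dx x + d ((m t).fn x) = g x
  boundary : ∀ t ∈ Ioo 0 S, HasBoundaryValues (p t) h

theorem DampingAssumption.differentiable {d₀ d₁ d₂ r : ℝ} {d : ℝ → ℝ}
    (hd : DampingAssumption d₀ d₁ d₂ r d) : Differentiable ℝ d :=
  hd.contDiff.differentiable one_ne_zero

theorem DampingAssumption.mul_sub_le {d₀ d₁ d₂ r : ℝ} {d : ℝ → ℝ}
    (hd : DampingAssumption d₀ d₁ d₂ r d) {a b : ℝ} (hab : a ≤ b) :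
    d₀ * (b - a) ≤ d b - d a :=
  mul_sub_le_image_sub_of_le_deriv hd.differentiable (fun s => (hd.lower s).le) hab

theorem DampingAssumption.mul_sq_le {d₀ d₁ d₂ r : ℝ} {d : ℝ → ℝ}
    (hd : DampingAssumption d₀ d₁ d₂ r d) (a b : ℝ) :
    d₀ * (a - b) ^ 2 ≤ (d a - d b) * (a - b) := by
  rcases le_total a b with h | h
  · nlinarith [hd.mul_sub_le h]
  · nlinarith [hd.mul_sub_le h]

theorem DampingAssumption.abs_sub_le {d₀ d₁ d₂ r : ℝ} {d : ℝ → ℝ}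
    (hd : DampingAssumption d₀ d₁ d₂ r d) (hd₂ : 0 ≤ d₂) (hr : 0 ≤ r) {R a b : ℝ}
    (ha : |a| ≤ R) (hb : |b| ≤ R) : |d a - d b| ≤ (d₁ + d₂ * R ^ r) * |a - b| := by
  refine (convex_Icc (-R) R).norm_image_sub_le_of_norm_deriv_le (𝕜 := ℝ) (f := d)
    (fun x _ => hd.differentiable x) (fun x hx => ?_) (abs_le.1 hb) (abs_le.1 ha)
  refine (hd.upper x).trans ?_
  gcongr
  exact abs_le.2 hx

theorem mul_norm_sq_le_inner {d₀ d₁ d₂ r : ℝ} {d : ℝ → ℝ}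
    (hd : DampingAssumption d₀ d₁ d₂ r d) {m₁ m₂ b : L2}
    (hb : ∀ᵐ x ∂unitMeasure, b x = d (m₁ x) - d (m₂ x)) :
    d₀ * ‖m₁ - m₂‖ ^ 2 ≤ ⟪b, m₁ - m₂⟫ := by
  rw [← real_inner_self_eq_norm_sq, inner_eq_integral, inner_eq_integral, ← integral_const_mul]
  have hi : ∀ u₁ u₂ : L2, Integrable (fun x => u₁ x * u₂ x) unitMeasure := fun u₁ u₂ =>
    (Lp.memLp u₁).integrable_mul (Lp.memLp u₂)
  refine integral_mono_ae ((hi _ _).const_mul d₀) (hi _ _) ?_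
  filter_upwards [hb, Lp.coeFn_sub m₁ m₂] with x h1 h2
  simp only [h1, h2, Pi.sub_apply]
  have := hd.mul_sq_le (m₁ x) (m₂ x)
  rwa [sq] at this

theorem norm_le_mul_norm_sub {d : ℝ → ℝ} {D R : ℝ}
    (hD : ∀ a b, |a| ≤ R → |b| ≤ R → |d a - d b| ≤ D * |a - b|) {m₁ m₂ b : L2}
    (h₁ : ∀ᵐ x ∂unitMeasure, |m₁ x| ≤ R) (h₂ : ∀ᵐ x ∂unitMeasure, |m₂ x| ≤ R)
    (hb : ∀ᵐ x ∂unitMeasure, b x = d (m₁ x) - d (m₂ x)) : ‖b‖ ≤ D * ‖m₁ - m₂‖ := by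
  refine Lp.norm_le_mul_norm_of_ae_le_mul ?_
  filter_upwards [h₁, h₂, hb, Lp.coeFn_sub m₁ m₂] with x e1 e2 e3 e4
  rw [e3, e4]
  exact hD _ _ e1 e2

namespace IsFlow

variable {d : ℝ → ℝ} {f g : L2} {h : EuclideanSpace ℝ (Fin 2)} {S : ℝ} {p₁ m₁ p₂ m₂ : ℝ → H1}
  {p₁' m₁' p₂' m₂' : ℝ → L2}

/-- The equations satisfied by the difference of two solutions. -/
theorem difference (h₁ : IsFlow d f g h S p₁ m₁ p₁' m₁') (h₂ : IsFlow d f g h S p₂ m₂ p₂' m₂')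
    {t : ℝ} (ht : t ∈ Ioo 0 S) :
    ∃ (qx vx b : L2) (c : ℝ), p₁' t - p₂' t = -vx ∧ m₁' t - m₂' t = -qx - b ∧
      (p₁ t).fn - (p₂ t).fn = J qx ∧ ⟪one, qx⟫ = (0 : ℝ) ∧
      (m₁ t).fn - (m₂ t).fn = c • one + J vx ∧
      ∀ᵐ x ∂unitMeasure, b x = d ((m₁ t).fn x) - d ((m₂ t).fn x) := by
  obtain ⟨c₁, hc₁⟩ := (m₁ t).exists_fn_eq
  obtain ⟨c₂, hc₂⟩ := (m₂ t).exists_fn_eq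
  obtain ⟨e₁, i₁⟩ := (h₁.boundary t ht).fn_eq
  obtain ⟨e₂, i₂⟩ := (h₂.boundary t ht).fn_eq
  -- `b` is read off from the momentum equations, so it lies in `L²` without any growth bound on
  -- `d`.
  refine ⟨(p₁ t).dx - (p₂ t).dx, (m₁ t).dx - (m₂ t).dx,
    -(m₁' t - m₂' t) - ((p₁ t).dx - (p₂ t).dx), c₁ - c₂, ?_, ?_, ?_, ?_, ?_, ?_⟩
  · rw [eq_sub_of_add_eq (h₁.mass t ht), eq_sub_of_add_eq (h₂.mass t ht)]
    abel
  · abel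
  · rw [e₁, e₂, map_sub]
    abel
  · rw [inner_sub_right]
    linarith
  · rw [hc₁, hc₂, map_sub, sub_smul]
    abel
  · filter_upwards [h₁.momentum t ht, h₂.momentum t ht,
      Lp.coeFn_sub (-(m₁' t - m₂' t)) ((p₁ t).dx - (p₂ t).dx), Lp.coeFn_neg (m₁' t - m₂' t),
      Lp.coeFn_sub (m₁' t) (m₂' t), Lp.coeFn_sub (p₁ t).dx (p₂ t).dx] with x a1 a2 a3 a4 a5 a6
    rw [a3, Pi.sub_apply, a4, Pi.neg_apply, a5, a6, Pi.sub_apply, Pi.sub_apply]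
    linarith

theorem hasDerivAt_energy {q v : ℝ → L2} {q' v' : L2} {t : ℝ} (hq : HasDerivAt q q' t)
    (hv : HasDerivAt v v' t) :
    HasDerivAt (fun s => energy (q s) (v s)) (⟪q t, q'⟫ + ⟪v t, v'⟫) t := by
  have := (hq.norm_sq.const_mul (1 / 2)).add (hv.norm_sq.const_mul (1 / 2))
  convert! this using 1
  ring

theorem continuousOn_energy {q v : ℝ → L2} {s : Set ℝ} (hq : ContinuousOn q s)
    (hv : ContinuousOn v s) : ContinuousOn (fun t => energy (q t) (v t)) s :=
  (continuousOn_const.mul (hq.norm.pow 2)).add (continuousOn_const.mul (hv.norm.pow 2))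

/-- The energy of the difference of two solutions does not grow. -/
theorem energy_sub_le {d₀ d₁ d₂ r : ℝ} (hd₀ : 0 < d₀) (hd : DampingAssumption d₀ d₁ d₂ r d)
    (h₁ : IsFlow d f g h S p₁ m₁ p₁' m₁') (h₂ : IsFlow d f g h S p₂ m₂ p₂' m₂')
    {t : ℝ} (ht : t ∈ Icc 0 S) :
    energy ((p₁ t).fn - (p₂ t).fn) ((m₁ t).fn - (m₂ t).fn)
      ≤ energy ((p₁ 0).fn - (p₂ 0).fn) ((m₁ 0).fn - (m₂ 0).fn) := by
  have key := le_exp_mul_of_hasDerivAt_le (γ := 0)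
    (continuousOn_energy (h₁.continuousOn_p.sub h₂.continuousOn_p)
      (h₁.continuousOn_m.sub h₂.continuousOn_m))
    (fun s hs => hasDerivAt_energy ((h₁.hasDerivAt_p s hs).sub (h₂.hasDerivAt_p s hs))
      ((h₁.hasDerivAt_m s hs).sub (h₂.hasDerivAt_m s hs))) (fun s hs => ?_) ht
  · simpa using key
  · obtain ⟨qx, vx, b, c, e1, e2, e3, e4, e5, e6⟩ := h₁.difference h₂ hs
    have i1 := inner_add_inner_eq_zero e3 e4 e5
    have i2 := mul_norm_sq_le_inner hd e6
    have i3 : 0 ≤ d₀ * ‖(m₁ s).fn - (m₂ s).fn‖ ^ 2 := by positivity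
    simp only [Pi.sub_apply, e1, e2, inner_neg_right, inner_sub_right, real_inner_comm b,
      neg_zero, zero_mul] at i2 ⊢
    linarith

/-- Exponential decay of the energy of the difference of two bounded solutions. -/
theorem energy_sub_le_exp {d₀ d₁ d₂ r D R : ℝ} (hd₀ : 0 < d₀) (hD0 : 0 ≤ D)
    (hd : DampingAssumption d₀ d₁ d₂ r d)
    (hD : ∀ a b, |a| ≤ R → |b| ≤ R → |d a - d b| ≤ D * |a - b|)
    (h₁ : IsFlow d f g h S p₁ m₁ p₁' m₁') (h₂ : IsFlow d f g h S p₂ m₂ p₂' m₂')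
    (hm₁ : ∀ t ∈ Ioo 0 S, ∀ᵐ x ∂unitMeasure, |(m₁ t).fn x| ≤ R)
    (hm₂ : ∀ t ∈ Ioo 0 S, ∀ᵐ x ∂unitMeasure, |(m₂ t).fn x| ≤ R)
    {t : ℝ} (ht : t ∈ Icc 0 S) :
    energy ((p₁ t).fn - (p₂ t).fn) ((m₁ t).fn - (m₂ t).fn)
      ≤ 3 * energy ((p₁ 0).fn - (p₂ 0).fn) ((m₁ 0).fn - (m₂ 0).fn)
        * Real.exp (-(2 / 3 * weight d₀ D) * t) := by
  have hcp := h₁.continuousOn_p.sub h₂.continuousOn_p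
  have hcm := h₁.continuousOn_m.sub h₂.continuousOn_m
  have key := le_exp_mul_of_hasDerivAt_le (γ := 2 / 3 * weight d₀ D)
    (L := fun s => lyapunov (weight d₀ D) ((p₁ s).fn - (p₂ s).fn) ((m₁ s).fn - (m₂ s).fn))
    ((continuousOn_energy hcp hcm).sub
      (continuousOn_const.mul (hcm.inner (𝕜 := ℝ) (K.continuous.comp_continuousOn hcp))))
    (fun s hs => (hasDerivAt_energy ((h₁.hasDerivAt_p s hs).sub (h₂.hasDerivAt_p s hs))
      ((h₁.hasDerivAt_m s hs).sub (h₂.hasDerivAt_m s hs))).sub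
      ((((h₁.hasDerivAt_m s hs).sub (h₂.hasDerivAt_m s hs)).inner ℝ
        (K.hasFDerivAt.comp_hasDerivAt s
          ((h₁.hasDerivAt_p s hs).sub (h₂.hasDerivAt_p s hs)))).const_mul (weight d₀ D)))
    (fun s hs => ?_) ht
  · have a1 := abs_le.1 (abs_cross_le (weight_pos hd₀ D).le (weight_le hd₀ D)
      ((p₁ t).fn - (p₂ t).fn) ((m₁ t).fn - (m₂ t).fn))
    have a2 := abs_le.1 (abs_cross_le (weight_pos hd₀ D).le (weight_le hd₀ D)
      ((p₁ 0).fn - (p₂ 0).fn) ((m₁ 0).fn - (m₂ 0).fn))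
    simp only [lyapunov] at key
    have := Real.exp_pos (-(2 / 3 * weight d₀ D) * t)
    -- The factor `3` is the ratio of the comparison constants `3/2` and `1/2`.
    nlinarith [a1.1, a1.2, a2.1, a2.2]
  · obtain ⟨qx, vx, b, c, e1, e2, e3, e4, e5, e6⟩ := h₁.difference h₂ hs
    have := lyapunov_dissipation hd₀ hD0 e3 e4 e5 (mul_norm_sq_le_inner hd e6)
      (norm_le_mul_norm_sub hD (hm₁ s hs) (hm₂ s hs) e6)
    simpa only [Pi.sub_apply, Function.comp_apply, e1, e2] using this

end IsFlow

end DampedWave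

/-! ### Steady states: existence, uniqueness and bounds. -/

namespace DampedWave

open scoped RealInnerProductSpace

/-- A bound for the derivative of the damping function on `[-R,R]`. -/
noncomputable def lipBound (d₁ d₂ r R : ℝ) : ℝ := d₁ + d₂ * R ^ r

theorem lipBound_nonneg {d₁ d₂ R : ℝ} (hd₁ : 0 ≤ d₁) (hd₂ : 0 ≤ d₂) (r : ℝ) (hR : 0 ≤ R) :
    0 ≤ lipBound d₁ d₂ r R := by
  unfold lipBound
  positivity

section

variable {d₀ d₁ d₂ r : ℝ} {d : ℝ → ℝ}

theorem DampingAssumption.abs_le_of_abs_le (hd : DampingAssumption d₀ d₁ d₂ r d) (hd₁ : 0 ≤ d₁)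
    (hd₂ : 0 ≤ d₂) (hr : 0 ≤ r) {R a : ℝ} (ha : |a| ≤ R) : |d a| ≤ lipBound d₁ d₂ r R * R := by
  have hR : 0 ≤ R := (abs_nonneg a).trans ha
  have h := hd.abs_sub_le hd₂ hr ha (by simpa using hR : |(0 : ℝ)| ≤ R)
  rw [hd.map_zero, sub_zero, sub_zero] at h
  exact h.trans (mul_le_mul_of_nonneg_left ha (lipBound_nonneg hd₁ hd₂ r hR))

theorem norm_le_of_ae_eq_damping (hd : DampingAssumption d₀ d₁ d₂ r d) (hd₁ : 0 ≤ d₁)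
    (hd₂ : 0 ≤ d₂) (hr : 0 ≤ r) {R : ℝ} (hR : 0 ≤ R) {u b : L2}
    (hu : ∀ᵐ x ∂unitMeasure, |u x| ≤ R) (hb : ∀ᵐ x ∂unitMeasure, b x = d (u x)) :
    ‖b‖ ≤ lipBound d₁ d₂ r R * R := by
  refine norm_le_of_ae_abs_le (mul_nonneg (lipBound_nonneg hd₁ hd₂ r hR) hR) ?_
  filter_upwards [hu, hb] with x h1 h2
  rw [h2]
  exact hd.abs_le_of_abs_le hd₁ hd₂ hr h1

theorem memLp_damping_add_prim (hd : DampingAssumption d₀ d₁ d₂ r d) (hd₁ : 0 ≤ d₁)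
    (hd₂ : 0 ≤ d₂) (hr : 0 ≤ r) (c : ℝ) (f : L2) :
    MemLp (fun x => d (c + prim f x)) 2 unitMeasure := by
  refine MemLp.of_bound (hd.contDiff.continuous.comp
    (continuous_const.add (continuous_prim f))).aestronglyMeasurable
    (lipBound d₁ d₂ r (|c| + ‖f‖) * (|c| + ‖f‖)) (Filter.Eventually.of_forall fun x => ?_)
  exact hd.abs_le_of_abs_le hd₁ hd₂ hr
    ((abs_add_le _ _).trans (add_le_add le_rfl (abs_prim_le f x)))

/-- The mean damping of the flux `c + ∫₀ˣ f`. -/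
noncomputable def meanDamping (d : ℝ → ℝ) (f : L2) (c : ℝ) : ℝ :=
  ∫ x in (0 : ℝ)..1, d (c + prim f x)

theorem intervalIntegrable_damping (hd : DampingAssumption d₀ d₁ d₂ r d) (f : L2) (c : ℝ) :
    IntervalIntegrable (fun x => d (c + prim f x)) volume 0 1 :=
  (hd.contDiff.continuous.comp
    (continuous_const.add (continuous_prim f))).intervalIntegrable _ _

theorem mul_sub_le_meanDamping (hd : DampingAssumption d₀ d₁ d₂ r d) (f : L2) {a b : ℝ}
    (hab : a ≤ b) : d₀ * (b - a) ≤ meanDamping d f b - meanDamping d f a := by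
  unfold meanDamping
  rw [← intervalIntegral.integral_sub (intervalIntegrable_damping hd f b)
    (intervalIntegrable_damping hd f a)]
  have h : ∫ _ in (0 : ℝ)..1, d₀ * (b - a) = d₀ * (b - a) := by simp
  rw [← h]
  refine intervalIntegral.integral_mono_on zero_le_one intervalIntegrable_const
    ((intervalIntegrable_damping hd f b).sub (intervalIntegrable_damping hd f a)) fun x _ => ?_
  have := hd.mul_sub_le (add_le_add_left hab (prim f x))
  linarith

theorem abs_sub_le_meanDamping (hd : DampingAssumption d₀ d₁ d₂ r d) (f : L2)
    (a b : ℝ) : d₀ * |b - a| ≤ |meanDamping d f b - meanDamping d f a| := by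
  rcases le_total a b with h | h
  · rw [abs_of_nonneg (sub_nonneg.2 h)]
    exact (mul_sub_le_meanDamping hd f h).trans (le_abs_self _)
  · rw [abs_sub_comm, abs_of_nonneg (sub_nonneg.2 h), abs_sub_comm (meanDamping d f b)]
    exact (mul_sub_le_meanDamping hd f h).trans (le_abs_self _)

/-- Continuity together with slope at least `d₀`, which forces divergence at both ends. -/
theorem surjective_meanDamping (hd₀ : 0 < d₀) (hd : DampingAssumption d₀ d₁ d₂ r d) (f : L2) :
    Function.Surjective (meanDamping d f) := by
  have hcont : Continuous (meanDamping d f) :=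
    intervalIntegral.continuous_parametric_intervalIntegral_of_continuous'
      (f := fun c x => d (c + prim f x)) (hd.contDiff.continuous.comp
        (continuous_fst.add ((continuous_prim f).comp continuous_snd))) 0 1
  refine hcont.surjective ?_ ?_
  · refine Filter.tendsto_atTop_mono' _ ?_ (Filter.tendsto_atTop_add_const_right _
      (meanDamping d f 0) (Filter.tendsto_id.const_mul_atTop hd₀))
    filter_upwards [Filter.eventually_ge_atTop 0] with c hc
    have := mul_sub_le_meanDamping hd f hc
    simp only [id]
    linarith
  · refine Filter.tendsto_atBot_mono' _ ?_ (Filter.tendsto_atBot_add_const_right _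
      (meanDamping d f 0) (Filter.tendsto_id.const_mul_atBot hd₀))
    filter_upwards [Filter.eventually_le_atBot 0] with c hc
    have := mul_sub_le_meanDamping hd f hc
    simp only [id]
    linarith

theorem integral_damping_eq_meanDamping {b u f : L2} {c : ℝ} (hu : u = c • one + J f)
    (hb : ∀ᵐ x ∂unitMeasure, b x = d (u x)) : ⟪one, b⟫ = meanDamping d f c := by
  rw [inner_one_left, meanDamping, intervalIntegral.integral_of_le zero_le_one,
    integral_Ioc_eq_integral_Ioo]
  have h := coeFn_const_add_J c f
  rw [← hu] at h
  refine integral_congr_ae ?_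
  filter_upwards [hb, h] with x h1 h2
  rw [h1, h2]

theorem abs_meanDamping_zero_le (hd : DampingAssumption d₀ d₁ d₂ r d) (hd₁ : 0 ≤ d₁)
    (hd₂ : 0 ≤ d₂) (hr : 0 ≤ r) (f : L2) {F : ℝ} (hf : ‖f‖ ≤ F) :
    |meanDamping d f 0| ≤ lipBound d₁ d₂ r F * F := by
  have h := intervalIntegral.norm_integral_le_of_norm_le_const (a := 0) (b := 1)
    (f := fun x => d (0 + prim f x)) (C := lipBound d₁ d₂ r F * F) fun x _ =>
      hd.abs_le_of_abs_le hd₁ hd₂ hr (by rw [zero_add]; exact (abs_prim_le f x).trans hf)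
  simpa [meanDamping] using h

variable {f g : L2} {h : EuclideanSpace ℝ (Fin 2)}

/-- The steady flux is `c + ∫₀ˣ f` and the pressure is obtained by integrating `g - d(m)` from `h
0`. The boundary condition at `1` becomes a scalar equation for `c`. -/
theorem exists_isSteadyState (hd₀ : 0 < d₀) (hd₁ : 0 ≤ d₁) (hd₂ : 0 ≤ d₂) (hr : 0 ≤ r)
    (hd : DampingAssumption d₀ d₁ d₂ r d) (f g : L2) (h : EuclideanSpace ℝ (Fin 2)) :
    ∃ p m : H1, IsSteadyState d f g h p m := by
  obtain ⟨c, hc⟩ := surjective_meanDamping hd₀ hd f (h 0 - h 1 + ⟪one, g⟫)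
  have hmem := memLp_damping_add_prim hd hd₁ hd₂ hr c f
  set b : L2 := hmem.toLp
  have hb : ∀ᵐ x ∂unitMeasure, b x = d ((c • one + J f : L2) x) := by
    filter_upwards [hmem.coeFn_toLp, coeFn_const_add_J c f] with x h1 h2
    rw [h1, h2]
  refine ⟨H1.ofDeriv (h 0) (g - b), H1.ofDeriv c f, rfl, ?_, ?_⟩
  · simp only [H1.dx_ofDeriv, H1.fn_ofDeriv]
    filter_upwards [hb, Lp.coeFn_sub g b] with x h1 h2
    rw [h2, Pi.sub_apply, h1, sub_add_cancel]
  · refine hasBoundaryValues_ofDeriv ?_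
    rw [inner_sub_right, integral_damping_eq_meanDamping rfl hb, hc]
    ring

namespace IsSteadyState

variable {p m p₂ m₂ : H1}

theorem ae_damping_eq (hs : IsSteadyState d f g h p m) :
    ∀ᵐ x ∂unitMeasure, (g - p.dx) x = d (m.fn x) := by
  filter_upwards [hs.momentum, Lp.coeFn_sub g p.dx] with x h1 h2
  rw [h2, Pi.sub_apply]
  linarith

theorem isFlow (hs : IsSteadyState d f g h p m) (S : ℝ) :
    IsFlow d f g h S (fun _ => p) (fun _ => m) (fun _ => 0) (fun _ => 0) where
  continuousOn_p := continuousOn_const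
  continuousOn_m := continuousOn_const
  hasDerivAt_p := fun t _ => hasDerivAt_const t _
  hasDerivAt_m := fun t _ => hasDerivAt_const t _
  mass := fun _ _ => by rw [zero_add, hs.mass]
  momentum := fun _ _ => by
    filter_upwards [hs.momentum, Lp.coeFn_zero ℝ 2 unitMeasure] with x h1 h2
    rw [h2, Pi.zero_apply, zero_add, h1]
  boundary := fun _ _ => hs.boundary

/-- Viewed as constant flows, two steady states have a difference whose energy identity reads
`d₀‖v‖² ≤ 0`; the pressures then agree by the momentum equation and the boundary value at `0`. -/
theorem unique (hd₀ : 0 < d₀) (hd : DampingAssumption d₀ d₁ d₂ r d)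
    (hs : IsSteadyState d f g h p m) (hs₂ : IsSteadyState d f g h p₂ m₂) : p = p₂ ∧ m = m₂ := by
  obtain ⟨qx, vx, b, c, e1, e2, e3, e4, e5, e6⟩ :=
    (hs.isFlow 1).difference (hs₂.isFlow 1) (t := 1 / 2) ⟨by norm_num, by norm_num⟩
  simp only [sub_self] at e1 e2
  have hvx : vx = 0 := neg_eq_zero.1 e1.symm
  have hb : b = -qx := (sub_eq_zero.1 e2.symm).symm
  have i1 := inner_add_inner_eq_zero e3 e4 e5
  have i2 := mul_norm_sq_le_inner hd e6
  rw [hvx, inner_zero_right, zero_add] at i1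
  rw [hb, inner_neg_left, real_inner_comm, i1, neg_zero] at i2
  have hv : ‖m.fn - m₂.fn‖ = 0 := by
    have : ‖m.fn - m₂.fn‖ ^ 2 ≤ 0 := by
      by_contra hpos
      nlinarith [mul_pos hd₀ (not_le.1 hpos)]
    exact pow_eq_zero_iff two_ne_zero |>.1 (le_antisymm this (sq_nonneg _))
  have hm : m.fn = m₂.fn := sub_eq_zero.1 (norm_eq_zero.1 hv)
  have hpx : p.dx = p₂.dx := by
    refine Lp.ext ?_
    filter_upwards [hs.momentum, hs₂.momentum] with x h1 h2
    rw [hm] at h1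
    linarith
  have hp : p.fn = p₂.fn := by rw [hs.boundary.fn_eq.1, hs₂.boundary.fn_eq.1, hpx]
  exact ⟨H1.ext hp hpx, H1.ext hm (hs.mass.trans hs₂.mass.symm)⟩

/-- The supremum of the steady flux is bounded in terms of the data. -/
theorem ae_abs_fn_le (hd₀ : 0 < d₀) (hd₁ : 0 ≤ d₁) (hd₂ : 0 ≤ d₂) (hr : 0 ≤ r)
    (hd : DampingAssumption d₀ d₁ d₂ r d) (hs : IsSteadyState d f g h p m) {F G H : ℝ}
    (hf : ‖f‖ ≤ F) (hg : ‖g‖ ≤ G) (hh : ‖h‖ ≤ H) :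
    ∀ᵐ x ∂unitMeasure, |m.fn x| ≤ (2 * H + G + lipBound d₁ d₂ r F * F) / d₀ + F := by
  obtain ⟨c, hc⟩ := m.exists_fn_eq
  rw [hs.mass] at hc
  have e1 := integral_damping_eq_meanDamping hc hs.ae_damping_eq
  rw [inner_sub_right] at e1
  have e2 := hs.boundary.fn_eq.2
  have e3 := abs_sub_le_meanDamping hd f 0 c
  have e4 := abs_meanDamping_zero_le hd hd₁ hd₂ hr f hf
  have b0 : |h 0| ≤ H := (PiLp.norm_apply_le h 0).trans hh
  have b1 : |h 1| ≤ H := (PiLp.norm_apply_le h 1).trans hh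
  have bg := (abs_inner_one_le g).trans hg
  -- The mean damping at `c` is `h 0 - h 1 + ∫ g`, and its slope is at least `d₀`.
  have hcb : |c| ≤ (2 * H + G + lipBound d₁ d₂ r F * F) / d₀ := by
    rw [le_div_iff₀ hd₀, mul_comm]
    rw [sub_zero] at e3
    refine e3.trans ((abs_sub _ _).trans (add_le_add ?_ e4))
    rw [← e1, abs_le]
    rw [abs_le] at b0 b1 bg
    constructor <;> linarith [b0.1, b0.2, b1.1, b1.2, bg.1, bg.2]
  have h' := coeFn_const_add_J c f
  rw [← hc] at h'
  filter_upwards [h'] with x hx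
  rw [hx]
  linarith [abs_add_le c (prim f x), abs_prim_le f x]

theorem norm_fn_le (hd₁ : 0 ≤ d₁) (hd₂ : 0 ≤ d₂) (hr : 0 ≤ r)
    (hd : DampingAssumption d₀ d₁ d₂ r d) (hs : IsSteadyState d f g h p m) {G H R : ℝ}
    (hR : 0 ≤ R) (hg : ‖g‖ ≤ G) (hh : ‖h‖ ≤ H) (hm : ∀ᵐ x ∂unitMeasure, |m.fn x| ≤ R) :
    ‖p.fn‖ ≤ H + G + lipBound d₁ d₂ r R * R := by
  have b0 : |h 0| ≤ H := (PiLp.norm_apply_le h 0).trans hh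
  have hb := norm_le_of_ae_eq_damping hd hd₁ hd₂ hr hR hm hs.ae_damping_eq
  have hdx : ‖p.dx‖ ≤ ‖g‖ + ‖g - p.dx‖ := by
    have := norm_sub_le g (g - p.dx)
    rwa [sub_sub_cancel] at this
  have hc : ‖h 0 • one‖ = |h 0| := by rw [norm_smul, norm_one_L2, mul_one, Real.norm_eq_abs]
  rw [hs.boundary.fn_eq.1]
  linarith [norm_add_le (h 0 • one) (J p.dx), norm_J_le p.dx]

end IsSteadyState

end

end DampedWave

/-! ### Estimates for time derivatives and the uniform bound on the flux. -/

namespace DampedWave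

open scoped RealInnerProductSpace Topology

theorem energy_smul (a : ℝ) (q v : L2) : energy (a • q) (a • v) = a ^ 2 * energy q v := by
  unfold energy
  rw [norm_smul, norm_smul, mul_pow, mul_pow, Real.norm_eq_abs, sq_abs]
  ring

theorem energy_le {q v : L2} {A B : ℝ} (hq : ‖q‖ ≤ A) (hv : ‖v‖ ≤ B) :
    energy q v ≤ 1 / 2 * A ^ 2 + 1 / 2 * B ^ 2 := by
  unfold energy
  gcongr

theorem norm_fst_le_sqrt {q v : L2} {A : ℝ} (h : energy q v ≤ A) : ‖q‖ ≤ √(2 * A) := by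
  refine Real.le_sqrt_of_sq_le ?_
  unfold energy at h
  nlinarith [sq_nonneg ‖v‖]

theorem norm_snd_le_sqrt {q v : L2} {A : ℝ} (h : energy q v ≤ A) : ‖v‖ ≤ √(2 * A) := by
  refine Real.le_sqrt_of_sq_le ?_
  unfold energy at h
  nlinarith [sq_nonneg ‖q‖]

theorem tendsto_difference_quotient {f : ℝ → L2} {f' : L2} {T t : ℝ}
    (hf : HasDerivWithinAt f f' (Icc 0 T) t) (ht : t ∈ Ico 0 T) :
    Filter.Tendsto (fun τ => τ⁻¹ • (f (t + τ) - f t)) (𝓝[>] 0) (𝓝 f') := by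
  have h1 : HasDerivWithinAt f f' (Ioi t) t := hf.mono_of_mem_nhdsWithin
    (Filter.mem_of_superset (Ioc_mem_nhdsGT ht.2) fun x hx => ⟨ht.1.trans hx.1.le, hx.2⟩)
  have h2 := (hasDerivWithinAt_iff_tendsto_slope' (by simp)).1 h1
  have h3 : Filter.Tendsto (fun τ => t + τ) (𝓝[>] 0) (𝓝[>] t) := by
    refine tendsto_nhdsWithin_iff.2 ⟨?_, ?_⟩
    · have : Filter.Tendsto (fun τ => t + τ) (𝓝 0) (𝓝 (t + 0)) :=
        (continuous_const.add continuous_id).tendsto 0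
      rw [add_zero] at this
      exact this.mono_left nhdsWithin_le_nhds
    · filter_upwards [self_mem_nhdsWithin] with τ hτ
      exact lt_add_of_pos_right t hτ
  refine (h2.comp h3).congr fun τ => ?_
  simp [slope]

namespace IsSolution

variable {d : ℝ → ℝ} {f g : L2} {h : EuclideanSpace ℝ (Fin 2)} {p₀ m₀ : H1} {T : ℝ}
  {p m : ℝ → H1}

theorem hasDerivWithinAt_p (hs : IsSolution d f g h p₀ m₀ T p m) {t : ℝ} (ht : t ∈ Icc 0 T) :
    HasDerivWithinAt (fun s => (p s).fn) (dt T p t) (Icc 0 T) t :=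
  (hs.contDiffOn_p.differentiableOn one_ne_zero t ht).hasDerivWithinAt

theorem hasDerivWithinAt_m (hs : IsSolution d f g h p₀ m₀ T p m) {t : ℝ} (ht : t ∈ Icc 0 T) :
    HasDerivWithinAt (fun s => (m s).fn) (dt T m t) (Icc 0 T) t :=
  (hs.contDiffOn_m.differentiableOn one_ne_zero t ht).hasDerivWithinAt

theorem continuousOn_dt_p (hs : IsSolution d f g h p₀ m₀ T p m) (hT : 0 < T) :
    ContinuousOn (dt T p) (Icc 0 T) :=
  hs.contDiffOn_p.continuousOn_derivWithin (uniqueDiffOn_Icc hT) le_rfl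

theorem continuousOn_dt_m (hs : IsSolution d f g h p₀ m₀ T p m) (hT : 0 < T) :
    ContinuousOn (dt T m) (Icc 0 T) :=
  hs.contDiffOn_m.continuousOn_derivWithin (uniqueDiffOn_Icc hT) le_rfl

/-- Time translates of solutions are solutions. -/
theorem isFlow_shift (hs : IsSolution d f g h p₀ m₀ T p m) {τ S : ℝ} (hτ : 0 ≤ τ)
    (hS : S + τ ≤ T) :
    IsFlow d f g h S (fun t => p (t + τ)) (fun t => m (t + τ))
      (fun t => dt T p (t + τ)) (fun t => dt T m (t + τ)) := by
  have hmaps : MapsTo (fun t => t + τ) (Icc 0 S) (Icc 0 T) := fun t ht =>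
    ⟨add_nonneg ht.1 hτ, (add_le_add_left ht.2 τ).trans hS⟩
  have hmem : ∀ t ∈ Ioo 0 S, t + τ ∈ Icc 0 T := fun t ht => hmaps (Ioo_subset_Icc_self ht)
  have hnhds : ∀ t ∈ Ioo 0 S, Icc 0 T ∈ 𝓝 (t + τ) := fun t ht =>
    Icc_mem_nhds (by linarith [ht.1]) (by linarith [ht.2])
  have hadd : ContinuousOn (fun t : ℝ => t + τ) (Icc 0 S) :=
    (continuous_id.add continuous_const).continuousOn
  exact {
    continuousOn_p := hs.contDiffOn_p.continuousOn.comp hadd hmaps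
    continuousOn_m := hs.contDiffOn_m.continuousOn.comp hadd hmaps
    hasDerivAt_p := fun t ht =>
      ((hs.hasDerivWithinAt_p (hmem t ht)).hasDerivAt (hnhds t ht)).comp_add_const t τ
    hasDerivAt_m := fun t ht =>
      ((hs.hasDerivWithinAt_m (hmem t ht)).hasDerivAt (hnhds t ht)).comp_add_const t τ
    mass := fun t ht => hs.mass _ (hmem t ht)
    momentum := fun t ht => hs.momentum _ (hmem t ht)
    boundary := fun t ht => hs.boundary _ (hmem t ht) }

theorem isFlow (hs : IsSolution d f g h p₀ m₀ T p m) {S : ℝ} (hS : S ≤ T) :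
    IsFlow d f g h S p m (dt T p) (dt T m) := by
  simpa using hs.isFlow_shift le_rfl (by simpa using hS)

/-- An estimate for all difference quotients in time passes to the time derivative. -/
theorem energy_dt_le (hs : IsSolution d f g h p₀ m₀ T p m) (hT : 0 < T) {C : ℝ → ℝ}
    (hC : Continuous C)
    (H : ∀ τ t, 0 < τ → 0 ≤ t → t + τ ≤ T →
      energy ((p (t + τ)).fn - (p t).fn) ((m (t + τ)).fn - (m t).fn)
        ≤ C t * energy ((p (0 + τ)).fn - (p 0).fn) ((m (0 + τ)).fn - (m 0).fn))
    {t : ℝ} (ht : t ∈ Icc 0 T) :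
    energy (dt T p t) (dt T m t) ≤ C t * energy (dt T p 0) (dt T m 0) := by
  have hlim : ∀ s ∈ Ico 0 T, Filter.Tendsto
      (fun τ => energy (τ⁻¹ • ((p (s + τ)).fn - (p s).fn)) (τ⁻¹ • ((m (s + τ)).fn - (m s).fn)))
      (𝓝[>] 0) (𝓝 (energy (dt T p s) (dt T m s))) := fun s hs' => by
    have h1 := tendsto_difference_quotient (hs.hasDerivWithinAt_p (Ico_subset_Icc_self hs')) hs'
    have h2 := tendsto_difference_quotient (hs.hasDerivWithinAt_m (Ico_subset_Icc_self hs')) hs'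
    exact ((h1.norm.pow 2).const_mul _).add ((h2.norm.pow 2).const_mul _)
  have hIco : ∀ s ∈ Ico 0 T,
      energy (dt T p s) (dt T m s) ≤ C s * energy (dt T p 0) (dt T m 0) := fun s hs' => by
    -- The energy is quadratic, so the estimate for differences scales to difference quotients.
    -- Right-sided quotients miss only `t = T`, which is reached by continuity of the time
    -- derivatives.
    refine le_of_tendsto_of_tendsto (hlim s hs')
      ((hlim 0 (left_mem_Ico.2 hT)).const_mul (C s)) ?_
    filter_upwards [Ioc_mem_nhdsGT (sub_pos.2 hs'.2)] with τ hτ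
    have := H τ s hτ.1 hs'.1 (by linarith [hτ.2])
    simp only [energy_smul]
    calc (τ⁻¹) ^ 2 * energy ((p (s + τ)).fn - (p s).fn) ((m (s + τ)).fn - (m s).fn)
        ≤ (τ⁻¹) ^ 2 * (C s * energy ((p (0 + τ)).fn - (p 0).fn) ((m (0 + τ)).fn - (m 0).fn)) :=
          mul_le_mul_of_nonneg_left this (sq_nonneg _)
      _ = _ := by ring
  have hcl : closure (Ico 0 T) = Icc 0 T := closure_Ico hT.ne
  refine le_on_closure hIco ?_ ?_ (hcl ▸ ht)
  · rw [hcl]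
    exact IsFlow.continuousOn_energy (hs.continuousOn_dt_p hT) (hs.continuousOn_dt_m hT)
  · exact (hC.mul continuous_const).continuousOn

variable {d₀ d₁ d₂ r : ℝ}

/-- Uses only monotonicity of `d`, hence is available before any sup bound on the flux. -/
theorem energy_dt_le_initial (hd₀ : 0 < d₀) (hd : DampingAssumption d₀ d₁ d₂ r d)
    (hs : IsSolution d f g h p₀ m₀ T p m) (hT : 0 < T) {t : ℝ} (ht : t ∈ Icc 0 T) :
    energy (dt T p t) (dt T m t) ≤ energy (dt T p 0) (dt T m 0) := by
  have := hs.energy_dt_le hT (C := fun _ => 1) continuous_const (fun τ s hτ hs0 hsτ => by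
    rw [one_mul]
    exact (hs.isFlow_shift hτ.le (S := s) hsτ).energy_sub_le hd₀ hd
      (hs.isFlow (by linarith)) ⟨hs0, le_rfl⟩) ht
  rwa [one_mul] at this

/-- The equations at `t = 0` express the initial time derivatives through `p₀`, `m₀` and the data.
-/
theorem energy_dt_zero_le (hd₁ : 0 ≤ d₁) (hd₂ : 0 ≤ d₂) (hr : 0 ≤ r)
    (hd : DampingAssumption d₀ d₁ d₂ r d) (hs : IsSolution d f g h p₀ m₀ T p m) (hT : 0 < T)
    {F G P M : ℝ} (hf : ‖f‖ ≤ F) (hg : ‖g‖ ≤ G) (hp₀ : ‖p₀‖ ≤ P) (hm₀ : ‖m₀‖ ≤ M) :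
    energy (dt T p 0) (dt T m 0) ≤ 1 / 2 * (F + M) ^ 2
      + 1 / 2 * (G + P + lipBound d₁ d₂ r (3 * M) * (3 * M)) ^ 2 := by
  have h0 : (0 : ℝ) ∈ Icc 0 T := left_mem_Icc.2 hT.le
  have hM : 0 ≤ M := (norm_nonneg _).trans hm₀
  have hmass := hs.mass 0 h0
  have hmom := hs.momentum 0 h0
  rw [hs.initial_m] at hmass hmom
  rw [hs.initial_p] at hmom
  refine energy_le ?_ ?_
  · rw [eq_sub_of_add_eq hmass]
    linarith [norm_sub_le f m₀.dx, m₀.norm_dx_le]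
  -- Sobolev's inequality, with both `‖m₀‖_{L²}` and `‖∂ₓm₀‖_{L²}` at most `M`.
  · have hsup : ∀ᵐ x ∂unitMeasure, |m₀.fn x| ≤ 3 * M := by
      filter_upwards [m₀.ae_abs_fn_le] with x hx
      linarith [m₀.norm_fn_le, m₀.norm_dx_le]
    have hb : ∀ᵐ x ∂unitMeasure, (g - p₀.dx - dt T m 0) x = d (m₀.fn x) := by
      filter_upwards [hmom, Lp.coeFn_sub (g - p₀.dx) (dt T m 0), Lp.coeFn_sub g p₀.dx]
        with x h1 h2 h3
      rw [h2, Pi.sub_apply, h3, Pi.sub_apply]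
      linarith
    have hle := norm_le_of_ae_eq_damping hd hd₁ hd₂ hr (by positivity) hsup hb
    have e1 := norm_sub_le (g - p₀.dx) (g - p₀.dx - dt T m 0)
    rw [sub_sub_cancel] at e1
    linarith [norm_sub_le g p₀.dx, p₀.norm_dx_le]

/-- Uniform bound for the flux in terms of bounds for the two energies. -/
theorem ae_abs_m_le (hd₀ : 0 < d₀) (hd : DampingAssumption d₀ d₁ d₂ r d)
    (hs : IsSolution d f g h p₀ m₀ T p m) (hT : 0 < T) {pbar mbar : H1}
    (hst : IsSteadyState d f g h pbar mbar) {F R A B : ℝ} (hf : ‖f‖ ≤ F) (hR : ‖mbar.fn‖ ≤ R)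
    (hA : energy (p₀.fn - pbar.fn) (m₀.fn - mbar.fn) ≤ A)
    (hB : energy (dt T p 0) (dt T m 0) ≤ B) {t : ℝ} (ht : t ∈ Icc 0 T) :
    ∀ᵐ x ∂unitMeasure, |(m t).fn x| ≤ R + √(2 * A) + 2 * (F + √(2 * B)) := by
  have e1 := (hs.isFlow le_rfl).energy_sub_le hd₀ hd (hst.isFlow T) ht
  rw [hs.initial_p, hs.initial_m] at e1
  have e2 := norm_snd_le_sqrt (e1.trans hA)
  have e3 := norm_fst_le_sqrt ((hs.energy_dt_le_initial hd₀ hd hT ht).trans hB)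
  have e4 : ‖(m t).dx‖ ≤ F + √(2 * B) := by
    rw [eq_sub_of_add_eq' (hs.mass t ht)]
    linarith [norm_sub_le f (dt T p t)]
  have e5 : ‖(m t).fn‖ ≤ R + √(2 * A) := by
    have := norm_add_le ((m t).fn - mbar.fn) mbar.fn
    rw [sub_add_cancel] at this
    linarith
  filter_upwards [(m t).ae_abs_fn_le] with x hx
  linarith

end IsSolution

end DampedWave
-- Choice of the constants and conclusion.
theorem theorem1
    (d₀ d₁ d₂ r : ℝ) (hd₀ : 0 < d₀) (hd₁ : 0 ≤ d₁) (hd₂ : 0 ≤ d₂) (hr : 0 ≤ r)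
    (F G H P M : ℝ) :
    ∃ c c' γ : ℝ, 0 < c ∧ 0 < c' ∧ 0 < γ ∧
      ∀ d : ℝ → ℝ, DampedWave.DampingAssumption d₀ d₁ d₂ r d →
      ∀ (f g : DampedWave.L2) (h : EuclideanSpace ℝ (Fin 2)),
        ‖f‖ ≤ F → ‖g‖ ≤ G → ‖h‖ ≤ H →
        (∃! s : DampedWave.H1 × DampedWave.H1, DampedWave.IsSteadyState d f g h s.1 s.2) ∧
        ∀ pbar mbar : DampedWave.H1, DampedWave.IsSteadyState d f g h pbar mbar →
        ∀ p₀ m₀ : DampedWave.H1, ‖p₀‖ ≤ P → ‖m₀‖ ≤ M →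
        ∀ T : ℝ, 0 < T →
        ∀ p m : ℝ → DampedWave.H1, DampedWave.IsSolution d f g h p₀ m₀ T p m →
        ∀ t ∈ Set.Icc 0 T,
          DampedWave.energy ((p t).fn - pbar.fn) ((m t).fn - mbar.fn) ≤ c * Real.exp (-γ * t) ∧
          DampedWave.energy (DampedWave.dt T p t) (DampedWave.dt T m t)
            ≤ c' * Real.exp (-γ * t) := by

  open DampedWave in
  -- The constants are fixed before the data, so the bounds may be negative; absolute values keep
  -- the expressions below nonnegative.
  set F₁ := |F|
  set G₁ := |G|
  set H₁ := |H|
  have hF₁ : 0 ≤ F₁ := abs_nonneg F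
  have hG₁ : 0 ≤ G₁ := abs_nonneg G
  have hH₁ : 0 ≤ H₁ := abs_nonneg H
  set Rs := (2 * H₁ + G₁ + lipBound d₁ d₂ r F₁ * F₁) / d₀ + F₁
  have hRs : 0 ≤ Rs := by
    have := mul_nonneg (lipBound_nonneg hd₁ hd₂ r hF₁) hF₁
    positivity
  set A := 1 / 2 * (P + (H₁ + G₁ + lipBound d₁ d₂ r Rs * Rs)) ^ 2 + 1 / 2 * (M + Rs) ^ 2
  set B := 1 / 2 * (F₁ + M) ^ 2
    + 1 / 2 * (G₁ + P + lipBound d₁ d₂ r (3 * M) * (3 * M)) ^ 2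
  have hA : 0 ≤ A := by positivity
  have hB : 0 ≤ B := by positivity
  -- `A` bounds the initial energy relative to the steady state, `B` that of the initial time
  -- derivatives, and `R` the flux in sup norm for all times.
  set R := Rs + √(2 * A) + 2 * (F₁ + √(2 * B))
  have hRsR : Rs ≤ R := by
    have := Real.sqrt_nonneg (2 * A)
    have := Real.sqrt_nonneg (2 * B)
    linarith
  have hD0 : 0 ≤ lipBound d₁ d₂ r R := lipBound_nonneg hd₁ hd₂ r (hRs.trans hRsR)
  -- The summand `1` keeps the constants positive when `A` or `B` is zero.
  refine ⟨3 * A + 1, 3 * B + 1, 2 / 3 * weight d₀ (lipBound d₁ d₂ r R), by positivity,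
    by positivity, mul_pos (by norm_num) (weight_pos hd₀ _), ?_⟩
  intro d hd f g h hf hg hh
  refine ⟨?_, ?_⟩
  · obtain ⟨p, m, hst⟩ := exists_isSteadyState hd₀ hd₁ hd₂ hr hd f g h
    refine ⟨(p, m), hst, fun s hs => ?_⟩
    obtain ⟨e1, e2⟩ := IsSteadyState.unique hd₀ hd hs hst
    exact Prod.ext e1 e2
  intro pbar mbar hst p₀ m₀ hp₀ hm₀ T hT p m hs t ht
  have hf := hf.trans (le_abs_self F)
  have hg := hg.trans (le_abs_self G)
  have hh := hh.trans (le_abs_self H)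
  have hms := hst.ae_abs_fn_le hd₀ hd₁ hd₂ hr hd hf hg hh
  have hmn : ‖mbar.fn‖ ≤ Rs := norm_le_of_ae_abs_le hRs hms
  have hpn := hst.norm_fn_le hd₁ hd₂ hr hd hRs hg hh hms
  have hEA : energy (p₀.fn - pbar.fn) (m₀.fn - mbar.fn) ≤ A := energy_le
    ((norm_sub_le _ _).trans (add_le_add (p₀.norm_fn_le.trans hp₀) hpn))
    ((norm_sub_le _ _).trans (add_le_add (m₀.norm_fn_le.trans hm₀) hmn))
  have hEB : energy (dt T p 0) (dt T m 0) ≤ B :=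
    hs.energy_dt_zero_le hd₁ hd₂ hr hd hT hf hg hp₀ hm₀
  have hsup : ∀ s ∈ Icc 0 T, ∀ᵐ x ∂unitMeasure, |(m s).fn x| ≤ R := fun s hs' =>
    hs.ae_abs_m_le hd₀ hd hT hst hf hmn hEA hEB hs'
  have hmsR : ∀ᵐ x ∂unitMeasure, |mbar.fn x| ≤ R := hms.mono fun x hx => hx.trans hRsR
  have hlip : ∀ a b, |a| ≤ R → |b| ≤ R → |d a - d b| ≤ lipBound d₁ d₂ r R * |a - b| :=
    fun a b ha hb => hd.abs_sub_le hd₂ hr ha hb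
  constructor
  · have key := (hs.isFlow le_rfl).energy_sub_le_exp hd₀ hD0 hd hlip (hst.isFlow T)
      (fun s hs' => hsup s (Ioo_subset_Icc_self hs')) (fun _ _ => hmsR) ht
    rw [hs.initial_p, hs.initial_m] at key
    exact key.trans (mul_le_mul_of_nonneg_right (by linarith) (Real.exp_pos _).le)
  · have key := hs.energy_dt_le hT
      (C := fun s => 3 * Real.exp (-(2 / 3 * weight d₀ (lipBound d₁ d₂ r R)) * s))
      (by fun_prop) (fun τ s hτ hs0 hsτ => by
        have := (hs.isFlow_shift hτ.le (S := s) hsτ).energy_sub_le_exp hd₀ hD0 hd hlip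
          (hs.isFlow (by linarith))
          (fun s' hs' => hsup _ ⟨by linarith [hs'.1], by linarith [hs'.2]⟩)
          (fun s' hs' => hsup _ ⟨hs'.1.le, by linarith [hs'.2]⟩) (t := s) ⟨hs0, le_rfl⟩
        exact this.trans_eq (by ring)) ht
    refine key.trans ?_
    rw [mul_right_comm]
    exact mul_le_mul_of_nonneg_right (by linarith) (Real.exp_pos _).le
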